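/- Consider one-way communication in the public-coin model: the two players share a random seed (drawn from a distribution that does not depend on the inputs), the first player sends a single message of $s$ bits, and the second player must output an answer. A protocol has failure probability $\delta$ if on every input pair satisfying the promise its answer is wrong with probability at most $\delta$ over the shared seed. $\mathbf{R}^{\rightarrow,pub}_\delta(f)$ denotes the least $s$ for which an $s$-bit protocol for $f$ with failure probability $\delta$ exists. In $\mathbf{UR}^{\subset}$ on $n$-bit strings, Alice receives $x\in\{0,1\}^n$ and Bob receives $y\in\{0,1\}^n$ together with $\|x\|_0$, the number of ones of $x$, with the promise that $\mathrm{support}(y)\subsetneq\mathrm{support}(x)$; Bob must output an index $i$ with $x_i\ne y_i$. In $\mathbf{AugIndex}_N$, Charlie receives $z\in\{0,1\}^N$, and Diane receives $j^*\in[N]$ and the bits $z_{j^*+1},\dots,z_N$; Diane must output $z_{j^*}$. Let $\log$ be the natural logarithm. **Theorem.** There are absolute constants $c_1,c_2>0$ such that for every integer $n\ge 1$ and every real $0<\delta<1/2$ with $\log\frac1\delta<\frac{n}{4e}$ there is an integer $N$ with $$c_1\log\tfrac1\delta\,\log^2\frac{n}{\log\frac1\delta}\ \le\ N\ \le\ c_2\log\tfrac1\delta\,\log^2\frac{n}{\log\frac1\delta}$$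 such that, for every $s$, if there is an $s$-bit protocol for $\mathbf{UR}^{\subset}$ on $n$-bit strings with failure probability $\delta$, then there is an $s$-bit protocol for $\mathbf{AugIndex}_N$ with failure probability $1/3$; that is, $$\mathbf{R}^{\rightarrow,pub}_{\delta}(\mathbf{UR}^{\subset})\ \ge\ \mathbf{R}^{\rightarrow,pub}_{1/3}(\mathbf{AugIndex}_N).$$ **Corollary.** There is an absolute constant $c>0$ such that for every integer $n\ge 2$ and every real $0<\delta<1/2$, $$\mathbf{R}^{\rightarrow,pub}_{\delta}(\mathbf{UR}^{\subset})\ \ge\ c\,\min\Bigl\{n,\ \log\tfrac1\delta\,\log^2\frac{n}{\log\frac1\delta}\Bigr\}.$$ -/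

import Mathlib

open scoped ENNReal

/-- A (promise, relational) two-party problem: the first player receives `x : X`, the second player
receives `y : Y`, the pair is promised to satisfy `promise x y`, and the second player has to output
some `z : Z` with `correct x y z`. -/
structure CommProblem where
  X : Type
  Y : Type
  Z : Type
  promise : X → Y → Prop
  correct : X → Y → Z → Prop

/-- A one-way public-coin protocol of cost `s` for the problem `F`: both players see the same random
seed, drawn from the distribution `law`; the first player sends a single message of `s` bits, which
depends on the seed and on the first player's input; the second player outputs an answer, which
depends on the seed, on the message and on the second player's input. -/
structure OneWayProtocol (F : CommProblem) (s : ℕ) where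
  Seed : Type
  law : PMF Seed
  message : Seed → F.X → (Fin s → Bool)
  output : Seed → (Fin s → Bool) → F.Y → F.Z

/-- The probability, over the public randomness, of a wrong answer on the input pair `(x, y)`. -/
noncomputable def OneWayProtocol.failProb {F : CommProblem} {s : ℕ} (P : OneWayProtocol F s)
    (x : F.X) (y : F.Y) : ℝ :=
  (P.law.toOuterMeasure {r | ¬ F.correct x y (P.output r (P.message r x) y)}).toReal

/-- There is an `s`-bit one-way public-coin protocol for `F` which on every input pair that satisfies
the promise fails with probability at most `δ`. -/
def CommProblem.HasProtocol (F : CommProblem) (δ : ℝ) (s : ℕ) : Prop :=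
  ∃ P : OneWayProtocol F s, ∀ x y, F.promise x y → P.failProb x y ≤ δ

/-- The one-way public-coin communication complexity of `F` with failure probability `δ`: the
least number of bits of a protocol (`⊤` if there is no protocol). -/
noncomputable def oneWayPubCC (δ : ℝ) (F : CommProblem) : ℕ∞ :=
  ⨅ (s : ℕ) (_ : F.HasProtocol δ s), (s : ℕ∞)

/-- The support-inclusion version of the universal relation on `n`-bit strings. Alice receives `x`;
Bob receives `y` together with the number of ones of `x`; it is promised that `x ≠ y` and that the
support of `y` is contained in the support of `x`. Bob has to output an index where `x` and `y`
differ. -/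
abbrev URSubset (n : ℕ) : CommProblem where
  X := Fin n → Bool
  Y := (Fin n → Bool) × ℕ
  Z := Fin n
  promise := fun x y => x ≠ y.1 ∧ (∀ i, y.1 i = true → x i = true) ∧
    y.2 = (Finset.univ.filter fun i => x i = true).card
  correct := fun x y i => x i ≠ y.1 i

/-- Augmented indexing on `N` bits. Charlie receives `z`; Diane receives an index `j` and the bits of
`z` at the positions after `j`. Diane has to output the bit of `z` at the position `j`. -/
abbrev AugIndex (N : ℕ) : CommProblem where
  X := Fin N → Bool
  Y := Σ j : Fin N, ({l : Fin N // j < l} → Bool)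
  Z := Bool
  promise := fun z y => ∀ l, y.2 l = z l.1
  correct := fun z y b => b = z y.1

/-- The quantity `log (1/δ) * (log (n / log (1/δ)))^2`. -/
noncomputable def urRate (n : ℕ) (δ : ℝ) : ℝ :=
  Real.log (1 / δ) * (Real.log (n / Real.log (1 / δ))) ^ 2

/-! The reduction to augmented indexing is trivial: Charlie can send `z` itself, so `AugIndex N` has
an error-free protocol for every `s ≥ N`. Everything rests on a direct bound: `s` is at least a
constant times `urRate n δ`, or times `n` when `δ` is tiny.

That bound is an encoding argument. An instance `a` gives each of `R * k` coordinates (level, block)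
one of `u = 2 ^ e` values. A coordinate of level `r` owns `64 ^ r` slots, and Alice's set is the
graph of `a` over the slots, moved into `Fin n` by an injection `π`. One message lets a decoder
query Bob many times, from the top level down. In the pass over level `r` Bob's set holds all higher
levels and the part already known, so a correct answer exposes a new coordinate. Averaged over `π`,
answers are symmetric among unknown slots (`card_isEvent_le`), so most fall on level `r`. About `k /
2` queries per level recover a constant fraction of the coordinates, while `sum_card_freshCoords_le`
bounds `e` times their average number by `s + 2 * (R * k)`.

Queries are adaptive, so a union bound over the possible query sets is needed. To keep its size free
of `R`, an answer `j` levels below makes a whole group of up to `2 ^ j` blocks known (`passLabel`):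
at most `2 * k` labels remain, and `δ ≤ 2 ^ (-O(k))` suffices. The decoder must be given the values
of such a group, but the factor `2 ^ j` is beaten by the ratio `64 ^ j` of level sizes. Taking `k`
of order `log (1 / δ)` and `R`, `e` of order `log (n / k)` gives the rate. -/

section LowerBound

open Finset

variable {R k u n : ℕ}

/-! ### Levels, blocks and group labels -/

/-- Positions of the hard instance: level, block, copy. -/
abbrev Slot (R k : ℕ) := Σ r : Fin R, Fin k × Fin (64 ^ (r : ℕ))

/-- The pair (level, block). -/
abbrev Coord (R k : ℕ) := Fin R × Fin k

/-- The level and the block of a slot. -/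
def Slot.coord (z : Slot R k) : Coord R k := (z.1, z.2.1)

/-- The group of a coordinate in the pass over level `r`: groups are singletons on level `r` and
have `2 ^ j` members `j` levels below. -/
def passLabel (r : ℕ) (c : Coord R k) : ℕ := (k + c.2) / 2 ^ (r - c.1)

theorem passLabel_lt (r : ℕ) (c : Coord R k) : passLabel r c < 2 * k := by
  have := c.2.isLt
  exact lt_of_le_of_lt (Nat.div_le_self _ _) (by omega)

theorem passLabel_self (r : Fin R) (i : Fin k) : passLabel (r : ℕ) ((r, i) : Coord R k) = k + i := by
  simp [passLabel]

theorem passLabel_lt_of_lt {r : ℕ} {c : Coord R k} (h : (c.1 : ℕ) < r) : passLabel r c < k := by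
  have := c.2.isLt
  obtain ⟨j, hj⟩ : ∃ j, r - (c.1 : ℕ) = j + 1 := ⟨r - c.1 - 1, by omega⟩
  unfold passLabel
  rw [hj, Nat.div_lt_iff_lt_mul (by positivity), pow_succ]
  have : 1 ≤ 2 ^ j := Nat.one_le_two_pow
  nlinarith

/-- Label `0` marks coordinates so far down that a group would outgrow the level. An answer there is
not progress; it is paid for by the loss. -/
theorem passLabel_eq_zero {r : ℕ} {c : Coord R k} (h : passLabel r c = 0) :
    k < 2 ^ (r - (c.1 : ℕ)) := by
  have h1 := (Nat.div_eq_zero_iff.1 h).resolve_left (by positivity)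
  omega

/-- For a power of two, a nonzero label determines the level. -/
theorem level_eq_of_passLabel_eq {κ r : ℕ} {c d : Coord R (2 ^ κ)} (hc : (c.1 : ℕ) ≤ r)
    (hd : (d.1 : ℕ) ≤ r) (h : passLabel r c = passLabel r d) (h0 : passLabel r c ≠ 0) :
    c.1 = d.1 := by
  -- `2 ^ κ + i` has binary logarithm `κ`, and dividing by `2 ^ j` lowers it by `j` as long as the
  -- quotient is nonzero.
  have key : ∀ e : Coord R (2 ^ κ), passLabel r e ≠ 0 →
      Nat.log 2 (passLabel r e) = κ - (r - e.1) ∧ r - (e.1 : ℕ) ≤ κ := by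
    intro e he
    have h1 : Nat.log 2 (2 ^ κ + (e.2 : ℕ)) = κ := by
      rw [Nat.log_eq_iff (by simp)]
      have := e.2.isLt
      rw [pow_succ]
      omega
    refine ⟨by rw [passLabel, Nat.log_div_base_pow, h1], ?_⟩
    by_contra hlt
    apply he
    rw [passLabel, Nat.div_eq_zero_iff]
    right
    have := e.2.isLt
    calc 2 ^ κ + (e.2 : ℕ) < 2 ^ (κ + 1) := by rw [pow_succ]; omega
      _ ≤ _ := Nat.pow_le_pow_right (by norm_num) (by omega)
  have h1 := key c h0
  have h2 := key d (h ▸ h0)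
  rw [h] at h1
  ext
  omega

theorem card_passLabel_fiber_le (r : ℕ) (l : Fin R) (x : ℕ) :
    (univ.filter fun c : Coord R k => c.1 = l ∧ passLabel r c = x).card ≤ 2 ^ (r - (l : ℕ)) := by
  rw [← card_range (2 ^ (r - (l : ℕ)))]
  refine card_le_card_of_injOn (fun c => (k + c.2) % 2 ^ (r - (l : ℕ))) ?_ ?_
  · intro c _
    simpa using Nat.mod_lt _ (by positivity)
  · rintro ⟨l1, i⟩ h1 ⟨l2, j⟩ h2 h
    obtain ⟨rfl, h3⟩ := (mem_filter.1 (mem_coe.1 h1)).2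
    obtain ⟨h5, h4⟩ := (mem_filter.1 (mem_coe.1 h2)).2
    obtain rfl : l2 = l1 := h5
    simp only [passLabel] at h3 h4 h
    have e1 := Nat.div_add_mod (k + i) (2 ^ (r - (l2 : ℕ)))
    have e2 := Nat.div_add_mod (k + j) (2 ^ (r - (l2 : ℕ)))
    rw [h3, h] at e1
    rw [h4] at e2
    have : (i : ℕ) = j := by omega
    simp [Fin.ext_iff, this]

/-- The slots which are removed by Bob in the pass over level `r` once the groups in `G` are
known. -/
def knownSlots (R k r : ℕ) (G : Finset ℕ) : Finset (Slot R k) :=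
  univ.filter fun z => r < z.1 ∨ passLabel r z.coord ∈ G

theorem mem_knownSlots {r : ℕ} {G : Finset ℕ} {z : Slot R k} :
    z ∈ knownSlots R k r G ↔ r < z.1 ∨ passLabel r z.coord ∈ G := by
  simp [knownSlots]

theorem knownSlots_mono {r : ℕ} {G G' : Finset ℕ} (h : G ⊆ G') :
    knownSlots R k r G ⊆ knownSlots R k r G' := by
  intro z
  simp only [mem_knownSlots]
  exact Or.imp_right (@h _)

/-- Many slots are unknown while few groups are known. -/
theorem le_card_compl_knownSlots (r : Fin R) (G : Finset ℕ) :
    (k - G.card) * 64 ^ (r : ℕ) ≤ (knownSlots R k r G)ᶜ.card := by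
  -- Slots of level `r` alone suffice: there a known group hides only one block.
  have h1 : ((univ.filter fun i : Fin k => k + (i : ℕ) ∉ G) ×ˢ
      (univ : Finset (Fin (64 ^ (r : ℕ))))).card ≤ (knownSlots R k r G)ᶜ.card := by
    refine card_le_card_of_injOn (fun p => ⟨r, p⟩) ?_ ?_
    · rintro ⟨i, c⟩ h
      simp only [mem_coe, mem_product, mem_filter, mem_univ, true_and, and_true] at h
      simp only [mem_coe, mem_compl, mem_knownSlots, Slot.coord, lt_irrefl,
        false_or]
      rwa [passLabel_self]
    · intro p _ p' _ h
      simpa using h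
  refine le_trans ?_ h1
  rw [card_product, card_univ, Fintype.card_fin]
  refine Nat.mul_le_mul_right _ ?_
  have h2 : (univ.filter fun i : Fin k => ¬ (k + (i : ℕ) ∉ G)).card ≤ G.card := by
    refine card_le_card_of_injOn (fun i => k + (i : ℕ)) ?_ ?_
    · intro i h
      simpa using h
    · intro i _ j _ h
      simpa [Fin.ext_iff] using h
  have h3 := card_filter_add_card_filter_not (s := (univ : Finset (Fin k)))
    (fun i : Fin k => k + (i : ℕ) ∉ G)
  rw [card_univ, Fintype.card_fin] at h3
  omega

/-! ### A pass of adaptive queries -/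

/-- The oracle `f` answers the query with known groups `G` by a new slot `z` of the instance. -/
def IsHit (f : Finset ℕ → Option (Slot R k × Fin u)) (a : Coord R k → Fin u) (r : ℕ)
    (G : Finset ℕ) (z : Slot R k) : Prop :=
  f G = some (z, a z.coord) ∧ z ∉ knownSlots R k r G

theorem IsHit.unique {f : Finset ℕ → Option (Slot R k × Fin u)} {a : Coord R k → Fin u} {r : ℕ}
    {G : Finset ℕ} {z z' : Slot R k} (h : IsHit f a r G z) (h' : IsHit f a r G z') : z = z' := by
  have := h.1.symm.trans h'.1
  simp only [Option.some.injEq, Prod.mk.injEq] at this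
  exact this.1

/-- The answer adds a new group. -/
def IsProgress (f : Finset ℕ → Option (Slot R k × Fin u)) (a : Coord R k → Fin u) (r : ℕ)
    (G : Finset ℕ) : Prop :=
  ∃ z, IsHit f a r G z ∧ passLabel r z.coord ≠ 0

open Classical in
/-- The known groups after one more query. -/
noncomputable def stepPass (f : Finset ℕ → Option (Slot R k × Fin u)) (a : Coord R k → Fin u)
    (r : ℕ) (G : Finset ℕ) : Finset ℕ :=
  if h : IsProgress f a r G then insert (passLabel r h.choose.coord) G else G

/-- The known groups after `t` queries. -/
noncomputable def runPass (f : Finset ℕ → Option (Slot R k × Fin u)) (a : Coord R k → Fin u)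
    (r t : ℕ) : Finset ℕ :=
  (stepPass f a r)^[t] ∅

section Run

variable {f : Finset ℕ → Option (Slot R k × Fin u)} {a : Coord R k → Fin u} {r : ℕ}

theorem stepPass_of_isHit {G : Finset ℕ} {z : Slot R k} (h : IsHit f a r G z)
    (h0 : passLabel r z.coord ≠ 0) : stepPass f a r G = insert (passLabel r z.coord) G := by
  have hp : IsProgress f a r G := ⟨z, h, h0⟩
  rw [stepPass, dif_pos hp, hp.choose_spec.1.unique h]

theorem stepPass_of_not {G : Finset ℕ} (h : ¬ IsProgress f a r G) : stepPass f a r G = G :=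
  dif_neg h

theorem runPass_zero : runPass f a r 0 = ∅ := rfl

theorem runPass_succ (t : ℕ) : runPass f a r (t + 1) = stepPass f a r (runPass f a r t) :=
  Function.iterate_succ_apply' _ _ _

theorem subset_stepPass (G : Finset ℕ) : G ⊆ stepPass f a r G := by
  by_cases h : IsProgress f a r G
  · obtain ⟨z, h, h0⟩ := h
    rw [stepPass_of_isHit h h0]
    exact subset_insert _ _
  · rw [stepPass_of_not h]

theorem runPass_mono {t t' : ℕ} (h : t ≤ t') : runPass f a r t ⊆ runPass f a r t' := by
  induction t', h using Nat.le_induction with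
  | base => exact Subset.rfl
  | succ t' _ ih => exact ih.trans (by rw [runPass_succ]; exact subset_stepPass _)

theorem IsHit.passLabel_notMem {G : Finset ℕ} {z : Slot R k} (h : IsHit f a r G z) :
    passLabel r z.coord ∉ G := fun h' => h.2 (mem_knownSlots.2 (Or.inr h'))

theorem IsHit.level_le {G : Finset ℕ} {z : Slot R k} (h : IsHit f a r G z) : (z.1 : ℕ) ≤ r :=
  not_lt.1 fun h' => h.2 (mem_knownSlots.2 (Or.inl h'))

theorem card_runPass_le (t : ℕ) : (runPass f a r t).card ≤ t := by
  induction t with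
  | zero => simp [runPass_zero]
  | succ t ih =>
    rw [runPass_succ]
    by_cases h : IsProgress f a r (runPass f a r t)
    · obtain ⟨z, h, h0⟩ := h
      rw [stepPass_of_isHit h h0, card_insert_of_notMem h.passLabel_notMem]
      omega
    · rw [stepPass_of_not h]
      omega

/-- Without progress the set of known groups stays the same, so the same query repeats forever;
progress at time `t` forces progress at all earlier times. -/
theorem card_runPass_of_isProgress {t : ℕ} (h : IsProgress f a r (runPass f a r t)) :
    (runPass f a r t).card = t := by
  induction t with
  | zero => simp [runPass_zero]
  | succ t ih =>
    rw [runPass_succ] at h ⊢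
    by_cases h' : IsProgress f a r (runPass f a r t)
    · have := ih h'
      obtain ⟨z, h, h0⟩ := h'
      rw [stepPass_of_isHit h h0, card_insert_of_notMem h.passLabel_notMem, this]
    · rw [stepPass_of_not h'] at h
      exact absurd h h'

theorem isProgress_of_card_runPass {t t' : ℕ} (h : (runPass f a r t).card = t) (ht : t' < t) :
    IsProgress f a r (runPass f a r t') := by
  by_contra hn
  have key : ∀ s, t' ≤ s → runPass f a r s = runPass f a r t' := by
    intro s hs
    induction s, hs using Nat.le_induction with
    | base => rfl
    | succ s _ ih => rw [runPass_succ, ih, stepPass_of_not hn]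
  rw [key t ht.le] at h
  have := card_runPass_le (f := f) (a := a) (r := r) t'
  omega

theorem exists_of_mem_runPass {t x : ℕ} (h : x ∈ runPass f a r t) :
    ∃ t' < t, ∃ z, IsHit f a r (runPass f a r t') z ∧ passLabel r z.coord = x ∧ x ≠ 0 := by
  induction t with
  | zero => simp [runPass_zero] at h
  | succ t ih =>
    by_cases hx : x ∈ runPass f a r t
    · obtain ⟨t', ht, z, hz⟩ := ih hx
      exact ⟨t', by omega, z, hz⟩
    · rw [runPass_succ] at h
      by_cases h' : IsProgress f a r (runPass f a r t)
      · obtain ⟨z, hz, h0⟩ := h'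
        rw [stepPass_of_isHit hz h0, mem_insert] at h
        have := h.resolve_right hx
        exact ⟨t, by omega, z, hz, this.symm, this ▸ h0⟩
      · rw [stepPass_of_not h'] at h
        exact absurd h hx

theorem runPass_subset_range (t : ℕ) : runPass f a r t ⊆ range (2 * k) := by
  intro x hx
  obtain ⟨_, _, z, _, rfl, _⟩ := exists_of_mem_runPass hx
  exact mem_range.2 (passLabel_lt _ _)

/-- The first `t` queries made progress, and the next one is answered by `z`. -/
def IsEvent (f : Finset ℕ → Option (Slot R k × Fin u)) (a : Coord R k → Fin u) (r t : ℕ)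
    (z : Slot R k) : Prop :=
  (runPass f a r t).card = t ∧ IsHit f a r (runPass f a r t) z

theorem IsHit.isEvent {t : ℕ} {z : Slot R k} (h : IsHit f a r (runPass f a r t) z)
    (h0 : passLabel r z.coord ≠ 0) : IsEvent f a r t z :=
  ⟨card_runPass_of_isProgress ⟨z, h, h0⟩, h⟩

theorem IsEvent.passLabel_mem {t q : ℕ} {z : Slot R k} (h : IsEvent f a r t z) (htq : t < q)
    (h0 : passLabel r z.coord ≠ 0) : passLabel r z.coord ∈ runPass f a r q := by
  refine runPass_mono (Nat.succ_le_of_lt htq) ?_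
  rw [Nat.succ_eq_add_one, runPass_succ, stepPass_of_isHit h.2 h0]
  exact mem_insert_self _ _

end Run

/-- The indicator string of a set. -/
def indicator (X : Finset (Fin n)) : Fin n → Bool := fun i => decide (i ∈ X)

/-- The instance `a` as a graph over the slots. -/
def graphEmb (a : Coord R k → Fin u) : Slot R k ↪ Slot R k × Fin u :=
  ⟨fun z => (z, a z.coord), fun _ _ h => congrArg Prod.fst h⟩

/-! ### Symmetry under the random embedding -/

section Oracle

variable {M : Type*} (msg : (Fin n → Bool) → M) (ans : M → (Fin n → Bool) × ℕ → Fin n)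
  (π : Slot R k × Fin u ↪ Fin n) (a : Coord R k → Fin u)

/-- Bob's answer, decoded along `π`, when Alice's set is the instance and Bob's set is the part
over `Z`. -/
noncomputable def reply (Z : Finset (Slot R k)) : Option (Slot R k × Fin u) :=
  Function.partialInv π (ans (msg (indicator (univ.map ((graphEmb a).trans π))))
    (indicator (Z.map ((graphEmb a).trans π)), Fintype.card (Slot R k)))

/-- The replies in the pass over level `r`. -/
noncomputable def oracle (r : ℕ) (G : Finset ℕ) : Option (Slot R k × Fin u) :=
  reply msg ans π a (knownSlots R k r G)

variable {π a} in
theorem reply_eq_some {Z : Finset (Slot R k)} {d : Slot R k × Fin u} :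
    reply msg ans π a Z = some d ↔ π d = ans (msg (indicator (univ.map ((graphEmb a).trans π))))
      (indicator (Z.map ((graphEmb a).trans π)), Fintype.card (Slot R k)) :=
  π.injective.isPartialInv d _

/-- The swap permutes Alice's set and, as `z` and `z'` lie outside `Z`, fixes Bob's. The protocol
sees the same inputs; only the decoding of its answer changes. -/
theorem reply_swap {Z : Finset (Slot R k)} {z z' : Slot R k} (hz : z ∉ Z) (hz' : z' ∉ Z)
    (d : Slot R k × Fin u) :
    reply msg ans ((Equiv.swap (graphEmb a z) (graphEmb a z')).toEmbedding.trans π) a Z = some d ↔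
      reply msg ans π a Z = some (Equiv.swap (graphEmb a z) (graphEmb a z') d) := by
  have h : (graphEmb a).trans ((Equiv.swap (graphEmb a z) (graphEmb a z')).toEmbedding.trans π) =
      (Equiv.swap z z').toEmbedding.trans ((graphEmb a).trans π) := by
    ext w
    simp [← (graphEmb a).injective.map_swap]
  have h2 : Z.map (Equiv.swap z z').toEmbedding = Z := by
    ext w
    rw [mem_map_equiv, Equiv.symm_swap]
    by_cases h1 : w = z
    · subst h1; simp [hz, hz']
    · by_cases h3 : w = z'
      · subst h3; simp [hz, hz']
      · rw [Equiv.swap_apply_of_ne_of_ne h1 h3]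
  have h4 : Z.map ((Equiv.swap z z').toEmbedding.trans ((graphEmb a).trans π)) =
      Z.map ((graphEmb a).trans π) := by rw [← map_map, h2]
  rw [reply_eq_some, reply_eq_some, h, h4, ← map_map, map_univ_equiv]
  rfl

-- Slots unknown at time `t` were unknown before, and all earlier answers lie in known groups. The
-- swap therefore leaves the run intact and turns only the answer at time `t` from `z` into `z'`.
variable {msg ans π a} in
theorem IsEvent.swap {r t : ℕ} {z z' : Slot R k} (h : IsEvent (oracle msg ans π a r) a r t z)
    (hz' : z' ∉ knownSlots R k r (runPass (oracle msg ans π a r) a r t)) :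
    runPass (oracle msg ans ((Equiv.swap (graphEmb a z) (graphEmb a z')).toEmbedding.trans π) a r)
      a r t = runPass (oracle msg ans π a r) a r t ∧
    IsEvent (oracle msg ans ((Equiv.swap (graphEmb a z) (graphEmb a z')).toEmbedding.trans π) a r)
      a r t z' := by
  set f := oracle msg ans π a r with hf
  set f' := oracle msg ans ((Equiv.swap (graphEmb a z) (graphEmb a z')).toEmbedding.trans π) a r
    with hf'
  have hz := h.2.2
  have key : ∀ s ≤ t, runPass f' a r s = runPass f a r s := by
    intro s
    induction s with
    | zero => intro _; rfl
    | succ s ih =>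
      intro hs
      rw [runPass_succ, runPass_succ, ih (by omega)]
      obtain ⟨w, hw, hw0⟩ := isProgress_of_card_runPass h.1 (t' := s) (by omega)
      have hwt : w ∈ knownSlots R k r (runPass f a r t) := by
        rw [mem_knownSlots]
        exact Or.inr ((hw.isEvent hw0).passLabel_mem (by omega) hw0)
      have hw' : IsHit f' a r (runPass f a r s) w := by
        refine ⟨?_, hw.2⟩
        have hsub := knownSlots_mono (R := R) (k := k) (r := r)
          (runPass_mono (f := f) (a := a) (r := r) (show s ≤ t by omega))
        have hne : Equiv.swap (graphEmb a z) (graphEmb a z') (w, a w.coord) = (w, a w.coord) := by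
          apply Equiv.swap_apply_of_ne_of_ne
          · intro e
            exact hz (by rw [← show w = z from congrArg Prod.fst e]; exact hwt)
          · intro e
            exact hz' (by rw [← show w = z' from congrArg Prod.fst e]; exact hwt)
        rw [hf', oracle, reply_swap _ _ _ _ (fun e => hz (hsub e)) (fun e => hz' (hsub e)), hne]
        exact hw.1
      rw [stepPass_of_isHit hw hw0, stepPass_of_isHit hw' hw0]
  have ht := key t le_rfl
  refine ⟨ht, by rw [ht]; exact h.1, ?_, by rw [ht]; exact hz'⟩
  rw [ht, hf', oracle, reply_swap _ _ _ _ hz hz']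
  have : Equiv.swap (graphEmb a z) (graphEmb a z') (z', a z'.coord) = (z, a z.coord) :=
    Equiv.swap_apply_right _ _
  rw [this]
  exact h.2.1

open Classical in
/-- By symmetry, each slot is the answer to the query at time `t` with small probability. -/
theorem card_isEvent_le (r : Fin R) (t : ℕ) (ht : 2 * t ≤ k) (z : Slot R k) :
    (univ.filter fun π : Slot R k × Fin u ↪ Fin n =>
      IsEvent (oracle msg ans π a r) a r t z).card * (k * 64 ^ (r : ℕ)) ≤
      2 * Fintype.card (Slot R k × Fin u ↪ Fin n) := by
  set E := univ.filter fun π : Slot R k × Fin u ↪ Fin n =>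
      IsEvent (oracle msg ans π a r) a r t z with hE
  let D : (Slot R k × Fin u ↪ Fin n) → Finset (Slot R k) := fun π =>
    (knownSlots R k r (runPass (oracle msg ans π a r) a r t))ᶜ
  -- The swapped embedding determines `w`, as its answer at time `t`, and then `π`.
  have h1 : (E.sigma D).card ≤ Fintype.card (Slot R k × Fin u ↪ Fin n) := by
    refine card_le_card_of_injOn
      (fun p => (Equiv.swap (graphEmb a z) (graphEmb a p.2)).toEmbedding.trans p.1)
      (t := univ) (fun _ _ => mem_coe.2 (mem_univ _)) ?_
    rintro ⟨π, w⟩ h ⟨π', w'⟩ h' e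
    simp only [mem_coe, mem_sigma, hE, mem_filter, mem_univ, true_and, D, mem_compl] at h h' e
    have e1 := (h.1.swap h.2).2
    have e2 := (h'.1.swap h'.2).2
    rw [e] at e1
    obtain rfl : w = w' := e1.2.unique e2.2
    have : π = π' := by
      ext d
      have := DFunLike.congr_fun e (Equiv.swap (graphEmb a z) (graphEmb a w) d)
      simpa using congrArg Fin.val this
    rw [this]
  have h2 : E.card * (k * 64 ^ (r : ℕ)) ≤ 2 * (E.sigma D).card := by
    rw [card_sigma, mul_sum, ← smul_eq_mul, ← sum_const]
    refine sum_le_sum fun π hπ => ?_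
    have hc := (mem_filter.1 hπ).2.1
    have := le_card_compl_knownSlots (k := k) r (runPass (oracle msg ans π a r) a r t)
    rw [hc] at this
    calc k * 64 ^ (r : ℕ) ≤ 2 * (k - t) * 64 ^ (r : ℕ) := Nat.mul_le_mul_right _ (by omega)
      _ = 2 * ((k - t) * 64 ^ (r : ℕ)) := by ring
      _ ≤ _ := Nat.mul_le_mul_left _ this
  omega

end Oracle

/-! ### Fresh coordinates against losses -/

section Found

open Classical

variable (F : Fin R → Finset ℕ → Option (Slot R k × Fin u)) (a : Coord R k → Fin u) (q : ℕ)

/-- The coordinates that are found in the pass over their level. -/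
noncomputable def foundCoords : Finset (Coord R k) :=
  univ.filter fun c => ∃ t < q, ∃ z : Slot R k, z.coord = c ∧ IsEvent (F c.1) a c.1 t z

/-- The coordinates that are revealed before the pass over their level. -/
noncomputable def revealedCoords : Finset (Coord R k) :=
  univ.filter fun c => ∃ r : Fin R, c.1 < r ∧ passLabel r c ∈ runPass (F r) a r q

/-- The coordinates that are found before they are revealed. -/
noncomputable def freshCoords : Finset (Coord R k) :=
  foundCoords F a q \ revealedCoords F a q

/-- All queries with few known groups are answered correctly. -/
def IsGood (f : Finset ℕ → Option (Slot R k × Fin u)) (r : ℕ) : Prop :=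
  ∀ G ∈ (range (2 * k)).powerset, G.card < q → ∃ z, IsHit f a r G z

/-- The weighted number of answers below the level `r` in the pass over level `r`. -/
noncomputable def passLoss (r : Fin R) : ℕ :=
  ∑ t ∈ range q, ∑ z : Slot R k,
    if z.1 < r ∧ IsEvent (F r) a r t z then 2 ^ ((r : ℕ) - z.1) else 0

variable {a q}

variable {F} in
theorem mem_foundCoords {c : Coord R k} : c ∈ foundCoords F a q ↔
    ∃ t < q, ∃ z : Slot R k, z.coord = c ∧ IsEvent (F c.1) a c.1 t z := by
  simp only [foundCoords, mem_filter, mem_univ, true_and]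

variable {F} in
theorem mem_revealedCoords {c : Coord R k} : c ∈ revealedCoords F a q ↔
    ∃ r : Fin R, c.1 < r ∧ passLabel r c ∈ runPass (F r) a r q := by
  simp only [revealedCoords, mem_filter, mem_univ, true_and]

theorem IsGood.card_runPass {f : Finset ℕ → Option (Slot R k × Fin u)} {r : ℕ}
    (hg : IsGood a q f r) (h0 : ∀ t < q, ∀ z, IsEvent f a r t z → passLabel r z.coord ≠ 0) :
    ∀ t ≤ q, (runPass f a r t).card = t := by
  intro t
  induction t with
  | zero => intro _; simp [runPass_zero]
  | succ t ih =>
    intro ht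
    have hc := ih (by omega)
    obtain ⟨z, hz⟩ := hg (runPass f a r t) (mem_powerset.2 (runPass_subset_range t)) (by omega)
    rw [runPass_succ, stepPass_of_isHit hz (h0 t (by omega) z ⟨hc, hz⟩),
      card_insert_of_notMem hz.passLabel_notMem, hc]

/-- If no event has label `0`, good queries add `q` distinct groups: labels from `k` on give found
coordinates of level `r`, and smaller ones come from lower levels and are charged to the loss. An
event of label `0` alone costs more than `k ≥ q`. -/
theorem IsGood.le_card_add {r : Fin R} (hg : IsGood a q (F r) r) (hq : q ≤ k) :
    q ≤ ((foundCoords F a q).filter fun c => c.1 = r).card + 2 * passLoss F a q r := by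
  by_cases h0 : ∀ t < q, ∀ z, IsEvent (F r) a r t z → passLabel r z.coord ≠ 0
  · have hc := hg.card_runPass h0 q le_rfl
    have h1 := card_filter_add_card_filter_not (s := runPass (F r) a r q) (fun x => k ≤ x)
    have h2 : ((runPass (F r) a r q).filter fun x => k ≤ x).card ≤
        ((foundCoords F a q).filter fun c => c.1 = r).card := by
      refine le_trans (card_le_card ?_) (card_image_le (f := fun c : Coord R k => k + (c.2 : ℕ)))
      intro x hx
      rw [mem_filter] at hx
      obtain ⟨t, ht, z, hz, rfl, hx0⟩ := exists_of_mem_runPass hx.1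
      have hlev : z.1 = r := by
        by_contra hne
        have : (z.coord.1 : ℕ) < r :=
          lt_of_le_of_ne hz.level_le fun e => hne (Fin.ext e)
        have := passLabel_lt_of_lt this
        omega
      subst hlev
      exact mem_image.2 ⟨z.coord, mem_filter.2 ⟨mem_foundCoords.2 ⟨t, ht, z, rfl,
        hz.isEvent hx0⟩, rfl⟩, (passLabel_self z.1 z.2.1).symm⟩
    have h3 : ((runPass (F r) a r q).filter fun x => ¬ k ≤ x).card ≤ passLoss F a q r := by
      have : passLoss F a q r = ∑ p ∈ (range q ×ˢ (univ : Finset (Slot R k))).filter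
          (fun p => p.2.1 < r ∧ IsEvent (F r) a r p.1 p.2), 2 ^ ((r : ℕ) - p.2.1) := by
        rw [passLoss, sum_filter, sum_product]
      rw [this]
      refine le_trans (card_le_card (t := ((range q ×ˢ (univ : Finset (Slot R k))).filter
          (fun p => p.2.1 < r ∧ IsEvent (F r) a r p.1 p.2)).image
          fun p => passLabel r p.2.coord) ?_) (card_image_le.trans ?_)
      · intro x hx
        rw [mem_filter] at hx
        obtain ⟨t, ht, z, hz, rfl, hx0⟩ := exists_of_mem_runPass hx.1
        refine mem_image.2 ⟨(t, z), mem_filter.2 ⟨mem_product.2 ⟨mem_range.2 ht, mem_univ _⟩,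
          ?_, hz.isEvent hx0⟩, rfl⟩
        refine lt_of_le_of_ne hz.level_le fun e => hx.2 ?_
        have e : z.1 = r := e
        subst e
        exact (Nat.le_add_right _ _).trans (passLabel_self z.1 z.2.1).ge
      · rw [card_eq_sum_ones]
        exact sum_le_sum fun p _ => Nat.one_le_two_pow
    omega
  · push Not at h0
    obtain ⟨t, ht, z, hz, h0⟩ := h0
    have h1 := passLabel_eq_zero h0
    have hlt : z.1 < r := by
      refine lt_of_le_of_ne hz.2.level_le fun e => ?_
      have e : z.1 = r := e
      subst e
      simp only [Slot.coord, Nat.sub_self, pow_zero] at h1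
      have := z.2.1.isLt
      omega
    have h2 : 2 ^ ((r : ℕ) - z.1) ≤ passLoss F a q r := by
      refine le_trans ?_ (single_le_sum (fun _ _ => Nat.zero_le _) (mem_range.2 ht))
      refine le_trans ?_ (single_le_sum (fun _ _ => Nat.zero_le _) (mem_univ z))
      rw [if_pos ⟨hlt, hz⟩]
    have h1 : k < 2 ^ ((r : ℕ) - z.1) := h1
    omega

/-- A revealed coordinate shares a nonzero label, hence its level, with an answered slot. Such a
group has at most as many members as the weight of that slot in `passLoss`. -/
theorem card_revealedCoords_le {κ : ℕ} (F : Fin R → Finset ℕ → Option (Slot R (2 ^ κ) × Fin u))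
    (a : Coord R (2 ^ κ) → Fin u) :
    (revealedCoords F a q).card ≤ ∑ r, passLoss F a q r := by
  have : ∑ r, passLoss F a q r = ∑ p ∈ (univ ×ˢ range q ×ˢ (univ : Finset (Slot R (2 ^ κ)))).filter
      (fun p : Fin R × ℕ × Slot R (2 ^ κ) => p.2.2.1 < p.1 ∧ IsEvent (F p.1) a p.1 p.2.1 p.2.2),
      2 ^ ((p.1 : ℕ) - p.2.2.1) := by
    rw [sum_filter, sum_product]
    refine sum_congr rfl fun r _ => ?_
    rw [sum_product, passLoss]
  rw [this]
  refine le_trans (card_le_card (t := Finset.biUnion _ fun p =>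
    univ.filter fun c : Coord R (2 ^ κ) => c.1 = p.2.2.1 ∧
      passLabel p.1 c = passLabel p.1 p.2.2.coord) ?_) (card_biUnion_le.trans (sum_le_sum fun p _ =>
      card_passLabel_fiber_le _ _ _))
  intro c hc
  obtain ⟨r, hr, hc⟩ := mem_revealedCoords.1 hc
  obtain ⟨t, ht, z, hz, h, h0⟩ := exists_of_mem_runPass hc
  have hl := level_eq_of_passLabel_eq (le_of_lt hr) hz.level_le h.symm h0
  refine mem_biUnion.2 ⟨(r, t, z), ?_, ?_⟩
  · refine mem_filter.2 ⟨by simpa using ht, ?_, hz.isEvent (h ▸ h0)⟩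
    have : z.coord.1 < r := hl ▸ hr
    exact this
  · exact mem_filter.2 ⟨mem_univ _, hl, h.symm⟩

/-- Every good pass finds many fresh coordinates, up to the losses. -/
theorem sum_isGood_le {κ : ℕ} (F : Fin R → Finset ℕ → Option (Slot R (2 ^ κ) × Fin u))
    (a : Coord R (2 ^ κ) → Fin u) (hq : q ≤ 2 ^ κ) :
    (∑ r, if IsGood a q (F r) r then q else 0) ≤
      (freshCoords F a q).card + 3 * ∑ r, passLoss F a q r := by
  have h1 : (∑ r, if IsGood a q (F r) r then q else 0) ≤
      ∑ r, (((foundCoords F a q).filter fun c => c.1 = r).card + 2 * passLoss F a q r) := by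
    refine sum_le_sum fun r _ => ?_
    split_ifs with h
    · exact h.le_card_add F hq
    · exact Nat.zero_le _
  rw [sum_add_distrib, ← card_eq_sum_card_fiberwise (fun _ _ => mem_coe.2 (mem_univ _)),
    ← mul_sum] at h1
  have h2 := card_revealedCoords_le (q := q) F a
  have h3 := le_card_sdiff (revealedCoords F a q) (foundCoords F a q)
  rw [freshCoords]
  omega

end Found

/-- Relative to `64 ^ r`, the level `j` steps below weighs `32 ^ (-j)`; the geometric series sums to
`1 / 31`. -/
theorem sum_two_pow_mul_le (r : ℕ) :
    31 * ∑ l ∈ range r, 2 ^ (r - l) * 64 ^ l ≤ 64 ^ r := by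
  induction r with
  | zero => simp
  | succ r ih =>
    have : ∑ l ∈ range r, 2 ^ (r + 1 - l) * 64 ^ l = 2 * ∑ l ∈ range r, 2 ^ (r - l) * 64 ^ l := by
      rw [mul_sum]
      refine sum_congr rfl fun l hl => ?_
      rw [Nat.succ_sub (mem_range.1 hl).le, pow_succ]
      ring
    rw [sum_range_succ, this, Nat.add_sub_cancel_left, pow_succ]
    omega

theorem sum_slot_le (r : Fin R) :
    31 * ∑ z : Slot R k, (if z.1 < r then 2 ^ ((r : ℕ) - z.1) else 0) ≤ k * 64 ^ (r : ℕ) := by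
  have h : ∑ z : Slot R k, (if z.1 < r then 2 ^ ((r : ℕ) - z.1) else 0) =
      k * ∑ l ∈ range r, 2 ^ ((r : ℕ) - l) * 64 ^ l := by
    rw [Fintype.sum_sigma]
    simp only [sum_const, card_univ, Fintype.card_prod, Fintype.card_fin, smul_eq_mul]
    rw [mul_sum]
    have h1 := Fin.sum_univ_eq_sum_range
      (fun l => k * 64 ^ l * (if l < (r : ℕ) then 2 ^ ((r : ℕ) - l) else 0)) R
    simp only [Fin.lt_def]
    rw [h1]
    simp only [mul_ite, mul_zero]
    rw [← sum_filter]
    refine sum_congr ?_ fun l _ => by ring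
    ext l
    have := r.isLt
    simp only [mem_filter, mem_range]
    omega
  rw [h]
  calc 31 * (k * ∑ l ∈ range r, 2 ^ ((r : ℕ) - l) * 64 ^ l) =
        k * (31 * ∑ l ∈ range r, 2 ^ ((r : ℕ) - l) * 64 ^ l) := by ring
    _ ≤ _ := Nat.mul_le_mul_left _ (sum_two_pow_mul_le _)

/-! ### Decoding and counting instances -/

section Decode

variable {M : Type*} (msg : (Fin n → Bool) → M) (ans : M → (Fin n → Bool) × ℕ → Fin n)
  (π : Slot R k × Fin u ↪ Fin n)

/-- Alice's message on the instance `a`. -/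
def instanceMessage (a : Coord R k → Fin u) : M :=
  msg (indicator (univ.map ((graphEmb a).trans π)))

variable {msg ans π}

theorem reply_congr {a b : Coord R k → Fin u} {Z : Finset (Slot R k)}
    (hM : instanceMessage msg π a = instanceMessage msg π b)
    (h : ∀ z ∈ Z, a z.coord = b z.coord) : reply msg ans π a Z = reply msg ans π b Z := by
  have h1 : Z.map ((graphEmb a).trans π) = Z.map ((graphEmb b).trans π) := by
    rw [map_eq_image, map_eq_image]
    refine image_congr fun z hz => ?_
    change π (z, a z.coord) = π (z, b z.coord)
    rw [h z hz]
  rw [instanceMessage, instanceMessage] at hM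
  rw [reply, reply, h1, hM]

/-- The instance is determined by the message, the progress flags, the set of fresh coordinates and
the values elsewhere. -/
theorem eq_of_message_eq {q : ℕ} {a b : Coord R k → Fin u}
    (hM : instanceMessage msg π a = instanceMessage msg π b)
    (hflag : ∀ r : Fin R, ∀ t < q,
      (IsProgress (oracle msg ans π a r) a r (runPass (oracle msg ans π a r) a r t) ↔
        IsProgress (oracle msg ans π b r) b r (runPass (oracle msg ans π b r) b r t)))
    (hH : ∀ c ∉ freshCoords (fun r : Fin R => oracle msg ans π a r) a q, a c = b c) : a = b := by
  have main : ∀ j : ℕ, ∀ c : Coord R k, R ≤ j + c.1 → a c = b c := by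
    intro j
    induction j with
    | zero =>
      intro c hc
      have := c.1.isLt
      omega
    | succ j ih =>
      rintro ⟨r, i⟩ hc
      have hup : ∀ c : Coord R k, r < c.1 → a c = b c := fun c h => ih c (by
        have : (r : ℕ) < c.1 := h
        simp only at hc
        omega)
      have key : ∀ t ≤ q, runPass (oracle msg ans π a r) a r t =
          runPass (oracle msg ans π b r) b r t ∧
          ∀ c : Coord R k, c.1 ≤ r → passLabel r c ∈ runPass (oracle msg ans π a r) a r t →
            a c = b c := by
        intro t
        induction t with
        | zero => intro _; simp [runPass_zero]
        | succ t iht =>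
          intro ht
          obtain ⟨h1, h2⟩ := iht (by omega)
          have hf := hflag r t (by omega)
          have hrep : oracle msg ans π a r (runPass (oracle msg ans π a r) a r t) =
              oracle msg ans π b r (runPass (oracle msg ans π a r) a r t) := by
            refine reply_congr hM fun z hz => ?_
            by_cases hz' : r < z.1
            · exact hup _ hz'
            · exact h2 _ (not_lt.1 hz') ((mem_knownSlots.1 hz).resolve_left hz')
          rw [← h1] at hf
          rw [runPass_succ, runPass_succ, ← h1]
          by_cases hp : IsProgress (oracle msg ans π a r) a r (runPass (oracle msg ans π a r) a r t)
          · obtain ⟨z', hz', hz0'⟩ := hf.1 hp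
            obtain ⟨z, hz, hz0⟩ := hp
            have he := (hz.1.symm.trans hrep).trans hz'.1
            simp only [Option.some.injEq, Prod.mk.injEq] at he
            obtain ⟨rfl, he⟩ := he
            rw [stepPass_of_isHit hz hz0, stepPass_of_isHit hz' hz0]
            refine ⟨rfl, fun c hcr hcl => ?_⟩
            rcases mem_insert.1 hcl with hcl | hcl
            · have hq := (hz.isEvent hz0).passLabel_mem (show t < q by omega) hz0
              rcases hcr.lt_or_eq with hlt | heq
              -- Members of a group below level `r` are revealed, so not fresh, and their values are
              -- given.
              · refine hH c fun hc => (mem_sdiff.1 hc).2 ?_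
                exact mem_revealedCoords.2 ⟨r, hlt, by rw [hcl]; exact hq⟩
              -- On level `r` the group is the answered coordinate alone, and the answer contains
              -- its value.
              · obtain ⟨cl, ci⟩ := c
                obtain rfl : cl = r := heq
                rw [passLabel_self] at hcl
                have hzl : z.1 = cl := by
                  by_contra hne
                  have := passLabel_lt_of_lt (c := z.coord)
                    (lt_of_le_of_ne hz.level_le fun e => hne (Fin.ext e))
                  omega
                have hzc : z.coord = (cl, z.2.1) := by rw [← hzl]; rfl
                rw [hzc, passLabel_self] at hcl
                have hci : ci = z.2.1 := Fin.ext (by omega)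
                rw [hci, ← hzc]
                exact he
            · exact h2 c hcr hcl
          · rw [stepPass_of_not hp, stepPass_of_not fun h => hp (hf.2 h)]
            exact ⟨rfl, h2⟩
      by_cases hm : (r, i) ∈ freshCoords (fun r : Fin R => oracle msg ans π a r) a q
      · obtain ⟨t, ht, z, hz, he⟩ := mem_foundCoords.1 (mem_sdiff.1 hm).1
        refine (key q le_rfl).2 _ le_rfl ?_
        have h0 : passLabel r z.coord ≠ 0 := by
          rw [hz, passLabel_self]
          have := i.isLt
          omega
        have := he.passLabel_mem ht h0
        rwa [hz] at this
      · exact hH _ hm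
  funext c
  exact main R c (by omega)

open Classical in
/-- A Kraft-type inequality for the fresh coordinates. -/
theorem sum_pow_card_freshCoords_le [Fintype M] {q : ℕ} (hq : q ≤ k) :
    ∑ a : Coord R k → Fin u, u ^ (freshCoords (fun r : Fin R => oracle msg ans π a r) a q).card ≤
      Fintype.card M * 2 ^ (2 * (R * k)) * u ^ (R * k) := by
  let key : (Coord R k → Fin u) → M × (Coord R k → Bool) × Finset (Coord R k) := fun a =>
    (instanceMessage msg π a,
      -- As `q ≤ k`, the blocks of a level can index the flags of its pass.
      fun c => decide (IsProgress (oracle msg ans π a c.1) a c.1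
        (runPass (oracle msg ans π a c.1) a c.1 c.2)),
      freshCoords (fun r : Fin R => oracle msg ans π a r) a q)
  rw [← sum_fiberwise univ key]
  have hcard : Fintype.card (M × (Coord R k → Bool) × Finset (Coord R k)) =
      Fintype.card M * 2 ^ (2 * (R * k)) := by
    simp only [Fintype.card_prod, Fintype.card_fun, Fintype.card_bool, Fintype.card_finset,
      Fintype.card_fin]
    ring
  rw [← hcard, ← card_univ, ← smul_eq_mul, ← sum_const]
  refine sum_le_sum ?_
  rintro ⟨m, φ, A⟩ _
  have h1 : ∑ a ∈ univ.filter (fun a => key a = (m, φ, A)),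
      u ^ (freshCoords (fun r : Fin R => oracle msg ans π a r) a q).card =
      (univ.filter (fun a => key a = (m, φ, A))).card * u ^ A.card := by
    rw [← smul_eq_mul, ← sum_const]
    refine sum_congr rfl fun a ha => ?_
    have := congrArg (fun x => x.2.2) (mem_filter.1 ha).2
    simp only [key] at this
    rw [this]
  have h2 : (univ.filter (fun a => key a = (m, φ, A))).card ≤ u ^ (Aᶜ).card := by
    have : u ^ (Aᶜ).card = (univ : Finset ({c // c ∈ Aᶜ} → Fin u)).card := by
      rw [card_univ, Fintype.card_fun, Fintype.card_fin, Fintype.card_coe]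
    rw [this]
    refine card_le_card_of_injOn (fun a c => a c.1) (fun _ _ => mem_coe.2 (mem_univ _)) ?_
    intro a ha b hb hab
    have ha' := (mem_filter.1 (mem_coe.1 ha)).2
    have hb' := (mem_filter.1 (mem_coe.1 hb)).2
    have hk := ha'.trans hb'.symm
    refine eq_of_message_eq (ans := ans) (q := q) (congrArg Prod.fst hk) ?_ ?_
    · intro r t ht
      have := congrFun (congrArg (fun x => x.2.1) hk) (r, ⟨t, by omega⟩)
      simpa only [key, decide_eq_decide] using this
    · intro c hc
      have h3 := congrArg (fun x => x.2.2) ha'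
      simp only [key] at h3
      rw [h3] at hc
      exact congrFun hab ⟨c, mem_compl.2 hc⟩
  rw [h1]
  calc _ ≤ u ^ (Aᶜ).card * u ^ A.card := Nat.mul_le_mul_right _ h2
    _ = u ^ (R * k) := by
      rw [← pow_add, card_compl_add_card, Fintype.card_prod, Fintype.card_fin, Fintype.card_fin]

open Classical in
/-- On average few coordinates are fresh. -/
theorem sum_card_freshCoords_le [Fintype M] [Nonempty M] {q e s : ℕ} (hq : q ≤ k)
    (hM : Fintype.card M = 2 ^ s)
    (π : Slot R k × Fin (2 ^ e) ↪ Fin n) :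
    e * ∑ a : Coord R k → Fin (2 ^ e),
      (freshCoords (fun r : Fin R => oracle msg ans π a r) a q).card ≤
      (s + 2 * (R * k)) * (2 ^ e) ^ (R * k) := by
  have h := sum_pow_card_freshCoords_le (msg := msg) (ans := ans) (π := π) hq
  rw [hM, ← pow_add] at h
  set g : (Coord R k → Fin (2 ^ e)) → ℕ := fun a =>
    (freshCoords (fun r : Fin R => oracle msg ans π a r) a q).card with hg
  set T := s + 2 * (R * k) with hT
  have hcard : ((2 : ℝ) ^ e) ^ (R * k) = Fintype.card (Coord R k → Fin (2 ^ e)) := by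
    simp
  have hR : ∑ a, ((2 : ℝ) ^ e) ^ g a ≤ 2 ^ T * (2 ^ e) ^ (R * k) := by exact_mod_cast h
  have hlog : 0 < Real.log 2 := Real.log_pos (by norm_num)
  -- The inequality `1 + x ≤ exp x` takes the place of Jensen's inequality.
  have hpt : ∀ a, 1 + ((e : ℝ) * g a - T) * Real.log 2 ≤ ((2 : ℝ) ^ e) ^ g a / 2 ^ T := by
    intro a
    have h1 : ((2 : ℝ) ^ e) ^ g a / 2 ^ T = Real.exp (((e : ℝ) * g a - T) * Real.log 2) := by
      rw [sub_mul, Real.exp_sub, ← pow_mul]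
      congr 1
      · rw [← Nat.cast_mul, Real.exp_nat_mul, Real.exp_log (by norm_num)]
      · rw [Real.exp_nat_mul, Real.exp_log (by norm_num)]
    rw [h1, add_comm]
    exact Real.add_one_le_exp _
  have hsum := sum_le_sum fun a (_ : a ∈ (univ : Finset (Coord R k → Fin (2 ^ e)))) => hpt a
  rw [← sum_div, sum_add_distrib, ← sum_mul, sum_sub_distrib, ← mul_sum] at hsum
  simp only [sum_const, card_univ, nsmul_eq_mul, mul_one] at hsum
  rw [← hcard] at hsum
  have h3 : (∑ a, ((2 : ℝ) ^ e) ^ g a) / 2 ^ T ≤ (2 ^ e) ^ (R * k) := by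
    rw [div_le_iff₀ (by positivity)]
    linarith
  have h4 : ((e : ℝ) * ∑ a, (g a : ℝ) - (2 ^ e) ^ (R * k) * T) * Real.log 2 ≤ 0 := by linarith
  have h5 : (e : ℝ) * ∑ a, (g a : ℝ) ≤ T * (2 ^ e) ^ (R * k) := by
    by_contra hlt
    push Not at hlt
    have : 0 < ((e : ℝ) * ∑ a, (g a : ℝ) - (2 ^ e) ^ (R * k) * T) * Real.log 2 :=
      mul_pos (by linarith) hlog
    linarith
  exact_mod_cast h5

end Decode

/-! ### Fixing the seed -/

open Classical in
/-- Some seed is bad for at most the expected number of events. -/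
theorem exists_seed_card_le {S ι : Type*} [Fintype ι] (p : PMF S) (B : ι → Set S) {δ : ℝ}
    (h : ∀ i, (p.toOuterMeasure (B i)).toReal ≤ δ) :
    ∃ ω, ((univ.filter fun i => ω ∈ B i).card : ℝ) ≤ δ * Fintype.card ι := by
  have : Nonempty S := p.support_nonempty.to_type
  let c : S → ℕ := fun ω => (univ.filter fun i => ω ∈ B i).card
  obtain ⟨ω₀, h₀⟩ : ∃ ω₀, ∀ ω, c ω₀ ≤ c ω :=
    ⟨Function.argmin c, fun ω => Function.argmin_le c ω⟩
  refine ⟨ω₀, ?_⟩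
  have hfin : ∀ i, p.toOuterMeasure (B i) ≠ ⊤ := fun i =>
    ((p.toOuterMeasure.mono (Set.subset_univ _)).trans_lt (by
      exact ((p.toOuterMeasure_apply_eq_one_iff _).2 (Set.subset_univ _)).trans_lt
        ENNReal.one_lt_top)).ne
  have h1 : (c ω₀ : ℝ≥0∞) ≤ ∑ i, p.toOuterMeasure (B i) := by
    calc (c ω₀ : ℝ≥0∞) = ∑' ω, p ω * c ω₀ := by rw [ENNReal.tsum_mul_right, p.tsum_coe, one_mul]
      _ ≤ ∑' ω, p ω * c ω := ENNReal.tsum_le_tsum fun ω => by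
          gcongr
          exact h₀ ω
      _ = ∑' ω, ∑ i, (B i).indicator p ω := by
          refine tsum_congr fun ω => ?_
          simp only [c, Set.indicator_apply]
          rw [← sum_filter, sum_const, nsmul_eq_mul, mul_comm]
      _ = ∑ i, p.toOuterMeasure (B i) := by
          rw [Summable.tsum_finsetSum fun _ _ => ENNReal.summable]
          exact sum_congr rfl fun i _ => (p.toOuterMeasure_apply _).symm
  have h2 := ENNReal.toReal_mono (ENNReal.sum_ne_top.2 fun i _ => hfin i) h1
  rw [ENNReal.toReal_natCast, ENNReal.toReal_sum fun i _ => hfin i] at h2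
  refine h2.trans ((sum_le_sum fun i _ => h i).trans ?_)
  rw [sum_const, card_univ, nsmul_eq_mul, mul_comm]

theorem exists_seed_forall_notMem {S ι : Type*} [Fintype ι] (p : PMF S) (B : ι → Set S) {δ : ℝ}
    (h : ∀ i, (p.toOuterMeasure (B i)).toReal ≤ δ) (hδ : δ * Fintype.card ι < 1) :
    ∃ ω, ∀ i, ω ∉ B i := by
  classical
  obtain ⟨ω, hω⟩ := exists_seed_card_le p B h
  have h1 := hω.trans_lt hδ
  rw [Nat.cast_lt_one, card_eq_zero] at h1
  exact ⟨ω, fun i hi => filter_eq_empty_iff.1 h1 (mem_univ i) hi⟩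

theorem indicator_eq_true {X : Finset (Fin n)} {i : Fin n} : indicator X i = true ↔ i ∈ X := by
  simp [indicator]

section Instance

variable (π : Slot R k × Fin u ↪ Fin n) (a : Coord R k → Fin u)

/-- Alice's string of the hard instance. -/
def aliceString : Fin n → Bool := indicator (univ.map ((graphEmb a).trans π))

/-- Bob's string of the hard instance in the pass over level `r`. -/
def bobString (r : ℕ) (G : Finset ℕ) : Fin n → Bool :=
  indicator ((knownSlots R k r G).map ((graphEmb a).trans π))

/-- Fewer than `k` groups leave an unknown slot on level `r`, so the inclusion is strict. The number
of ones is the number of slots for every `a`, so it tells Bob nothing. -/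
theorem promise_hardInstance (r : Fin R) {G : Finset ℕ} (hG : G.card < k) :
    (URSubset n).promise (aliceString π a) (bobString π a r G, Fintype.card (Slot R k)) := by
  refine ⟨?_, ?_, ?_⟩
  · have h1 := le_card_compl_knownSlots (k := k) r G
    have h2 : 0 < (k - G.card) * 64 ^ (r : ℕ) := Nat.mul_pos (by omega) (by positivity)
    obtain ⟨z, hz⟩ := card_pos.1 (h2.trans_le h1)
    intro h
    have h3 : bobString π a r G ((graphEmb a).trans π z) = true := by
      refine (congrFun h _).symm.trans ?_
      exact indicator_eq_true.2 (mem_map_of_mem _ (mem_univ z))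
    exact mem_compl.1 hz ((mem_map' _).1 (indicator_eq_true.1 h3))
  · intro i hi
    exact indicator_eq_true.2 (map_subset_map.2 (subset_univ _) (indicator_eq_true.1 hi))
  · have : (univ.filter fun i => aliceString π a i = true) = univ.map ((graphEmb a).trans π) := by
      ext i
      simp only [mem_filter, mem_univ, true_and]
      exact indicator_eq_true
    rw [this, card_map, card_univ]

theorem exists_isHit_of_correct {M : Type*} (msg : (Fin n → Bool) → M)
    (ans : M → (Fin n → Bool) × ℕ → Fin n) (r : ℕ) (G : Finset ℕ)
    (h : (URSubset n).correct (aliceString π a) (bobString π a r G, Fintype.card (Slot R k))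
      (ans (msg (aliceString π a)) (bobString π a r G, Fintype.card (Slot R k)))) :
    ∃ z, IsHit (oracle msg ans π a r) a r G z := by
  set i := ans (msg (aliceString π a)) (bobString π a r G, Fintype.card (Slot R k)) with hi
  have h1 : i ∈ univ.map ((graphEmb a).trans π) := by
    by_contra hn
    apply h
    have h2 : i ∉ (knownSlots R k r G).map ((graphEmb a).trans π) :=
      fun h => hn (map_subset_map.2 (subset_univ _) h)
    change decide _ = decide _
    rw [decide_eq_decide]
    exact ⟨fun h => absurd h hn, fun h => absurd h h2⟩
  obtain ⟨z, _, hz⟩ := mem_map.1 h1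
  refine ⟨z, ?_, fun hk => h ?_⟩
  · rw [oracle, reply_eq_some]
    exact hz
  · have h2 : i ∈ (knownSlots R k r G).map ((graphEmb a).trans π) := hz ▸ mem_map_of_mem _ hk
    change decide _ = decide _
    rw [decide_eq_decide]
    exact ⟨fun _ => h2, fun _ => h1⟩

end Instance

open Classical in
/-- The average loss of a pass is a small fraction of the number of queries. -/
theorem sum_passLoss_le {M : Type*} (msg : (Fin n → Bool) → M)
    (ans : M → (Fin n → Bool) × ℕ → Fin n) (a : Coord R k → Fin u) (r : Fin R) {q : ℕ}
    (hk : 0 < k) (hq : 2 * q ≤ k + 2) :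
    31 * ∑ π : Slot R k × Fin u ↪ Fin n, passLoss (fun r : Fin R => oracle msg ans π a r) a q r ≤
      2 * q * Fintype.card (Slot R k × Fin u ↪ Fin n) := by
  set Q := Fintype.card (Slot R k × Fin u ↪ Fin n) with hQ
  have h0 : 0 < k * 64 ^ (r : ℕ) := by positivity
  refine Nat.le_of_mul_le_mul_right ?_ h0
  have h1 : ∑ π : Slot R k × Fin u ↪ Fin n,
      passLoss (fun r : Fin R => oracle msg ans π a r) a q r =
      ∑ t ∈ range q, ∑ z : Slot R k, (if z.1 < r then 2 ^ ((r : ℕ) - z.1) else 0) *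
        (univ.filter fun π : Slot R k × Fin u ↪ Fin n =>
          IsEvent (oracle msg ans π a r) a r t z).card := by
    simp only [passLoss]
    rw [sum_comm]
    refine sum_congr rfl fun t _ => ?_
    rw [sum_comm]
    refine sum_congr rfl fun z _ => ?_
    by_cases hz : z.1 < r
    · simp only [hz, true_and, if_true]
      rw [← sum_filter, sum_const, smul_eq_mul, mul_comm]
    · simp [hz]
  have h2 : (∑ t ∈ range q, ∑ z : Slot R k, (if z.1 < r then 2 ^ ((r : ℕ) - z.1) else 0) *
        (univ.filter fun π : Slot R k × Fin u ↪ Fin n =>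
          IsEvent (oracle msg ans π a r) a r t z).card) * (k * 64 ^ (r : ℕ)) ≤
      ∑ t ∈ range q, ∑ z : Slot R k, (if z.1 < r then 2 ^ ((r : ℕ) - z.1) else 0) * (2 * Q) := by
    rw [sum_mul]
    refine sum_le_sum fun t ht => ?_
    rw [sum_mul]
    refine sum_le_sum fun z _ => ?_
    rw [mul_assoc]
    have := mem_range.1 ht
    exact Nat.mul_le_mul_left _ (card_isEvent_le msg ans a r t (by omega) z)
  have h3 := sum_slot_le (k := k) r
  rw [sum_const, card_range, smul_eq_mul, ← sum_mul] at h2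
  rw [h1]
  calc _ = 31 * (_ * (k * 64 ^ (r : ℕ))) := by rw [mul_assoc]
    _ ≤ 31 * (q * ((∑ z : Slot R k, (if z.1 < r then 2 ^ ((r : ℕ) - z.1) else 0)) * (2 * Q))) :=
        Nat.mul_le_mul_left _ h2
    _ = 2 * q * Q * (31 * ∑ z : Slot R k, (if z.1 < r then 2 ^ ((r : ℕ) - z.1) else 0)) := by ring
    _ ≤ _ := Nat.mul_le_mul_left _ h3

/-- The exponent `k - 1` matters at `k = 1`, where only `∅` is queried and every `δ < 1 / 2` is
allowed. -/
theorem card_smallFamily_le (hk : 0 < k) :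
    ((range (2 * k)).powerset.filter fun G => G.card < (k + 1) / 2).card ≤ 16 ^ (k - 1) := by
  rcases (show k = 1 ∨ 2 ≤ k by omega) with rfl | h
  · decide
  · refine (card_filter_le _ _).trans ?_
    rw [card_powerset, card_range, show 16 = 2 ^ 4 by norm_num, ← pow_mul]
    exact Nat.pow_le_pow_right (by norm_num) (by omega)

open Classical in
/-- Fixing the seed: on half of the instances all relevant queries are answered correctly. -/
theorem exists_deterministic {s : ℕ} {δ : ℝ} (hk : 0 < k) (hR : 0 < R) (hu : 0 < u)
    (hne : Nonempty (Slot R k × Fin u ↪ Fin n)) (hδ : (16 : ℝ) ^ (k - 1) * δ ≤ 1 / 2)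
    (hP : (URSubset n).HasProtocol δ s) :
    ∃ (msg : (Fin n → Bool) → (Fin s → Bool))
      (ans : (Fin s → Bool) → (Fin n → Bool) × ℕ → Fin n),
      (Fintype.card (Slot R k × Fin u ↪ Fin n) : ℝ) * Fintype.card (Coord R k → Fin u) * R / 2 ≤
        (univ.filter fun p : (Slot R k × Fin u ↪ Fin n) × (Coord R k → Fin u) × Fin R =>
          IsGood p.2.1 ((k + 1) / 2) (oracle msg ans p.1 p.2.1 p.2.2) p.2.2).card := by
  obtain ⟨P, hP⟩ := hP
  let Fam : Finset (Finset ℕ) := (range (2 * k)).powerset.filter fun G => G.card < (k + 1) / 2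
  -- One average over embeddings, instances, levels and query sets: since `δ` times the size of
  -- `Fam` is at most `1 / 2`, at most half of the passes meet a wrong answer.
  obtain ⟨ω, hω⟩ := exists_seed_card_le P.law
    (fun i : ((Slot R k × Fin u ↪ Fin n) × (Coord R k → Fin u) × Fin R) × Fam =>
      {ω | ¬ (URSubset n).correct (aliceString i.1.1 i.1.2.1)
        (bobString i.1.1 i.1.2.1 i.1.2.2 i.2, Fintype.card (Slot R k))
        (P.output ω (P.message ω (aliceString i.1.1 i.1.2.1))
          (bobString i.1.1 i.1.2.1 i.1.2.2 i.2, Fintype.card (Slot R k)))})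
    (δ := δ) (by
      rintro ⟨⟨π, a, r⟩, G, hG⟩
      have : G.card < (k + 1) / 2 := (mem_filter.1 hG).2
      exact hP _ _ (promise_hardInstance π a r (show G.card < k by omega)))
  refine ⟨P.message ω, P.output ω, ?_⟩
  let Good : (Slot R k × Fin u ↪ Fin n) × (Coord R k → Fin u) × Fin R → Prop := fun p =>
    IsGood p.2.1 ((k + 1) / 2) (oracle (P.message ω) (P.output ω) p.1 p.2.1 p.2.2) p.2.2
  have hbad : ((univ.filter fun p => ¬ Good p).card : ℝ) ≤ δ *
      Fintype.card (((Slot R k × Fin u ↪ Fin n) × (Coord R k → Fin u) × Fin R) × Fam) := by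
    refine le_trans (Nat.cast_le.2 ?_) hω
    refine le_trans (card_le_card ?_) (card_image_le (f := Prod.fst))
    rintro ⟨π, a, r⟩ hp
    have hp := (mem_filter.1 hp).2
    simp only [Good, IsGood] at hp
    push Not at hp
    obtain ⟨G, hG, hGc, hno⟩ := hp
    have hGF : G ∈ Fam := mem_filter.2 ⟨hG, hGc⟩
    refine mem_image.2 ⟨⟨⟨π, a, r⟩, G, hGF⟩, ?_, rfl⟩
    refine (@mem_filter _ _ (fun _ => Classical.propDecidable _) _ _).2 ⟨mem_univ _, fun hc => ?_⟩
    obtain ⟨z, hz⟩ := exists_isHit_of_correct π a _ _ r G hc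
    exact hno z hz
  have hFam : (Fintype.card Fam : ℝ) ≤ 16 ^ (k - 1) := by
    rw [Fintype.card_coe]
    exact_mod_cast card_smallFamily_le hk
  have hδ0 : 0 ≤ δ := by
    obtain ⟨π⟩ := hne
    exact ENNReal.toReal_nonneg.trans (hP _ _ (promise_hardInstance π (fun _ => ⟨0, hu⟩)
      (⟨0, hR⟩ : Fin R) (G := ∅) (by simpa using hk)))
  have h1 := card_filter_add_card_filter_not
    (s := (univ : Finset ((Slot R k × Fin u ↪ Fin n) × (Coord R k → Fin u) × Fin R))) Good
  rw [card_univ] at h1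
  change _ ≤ ((univ.filter Good).card : ℝ)
  have h4 : (Fintype.card Fam : ℝ) * δ ≤ 1 / 2 :=
    (mul_le_mul_of_nonneg_right hFam hδ0).trans hδ
  have hT : Fintype.card ((Slot R k × Fin u ↪ Fin n) × (Coord R k → Fin u) × Fin R) =
      Fintype.card (Slot R k × Fin u ↪ Fin n) * (Fintype.card (Coord R k → Fin u) * R) := by
    rw [Fintype.card_prod, Fintype.card_prod, Fintype.card_fin]
  rw [Fintype.card_prod, hT] at hbad
  rw [hT] at h1
  have h2 : ((univ.filter Good).card : ℝ) + (univ.filter fun p => ¬ Good p).card =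
      Fintype.card (Slot R k × Fin u ↪ Fin n) * (Fintype.card (Coord R k → Fin u) * R) := by
    exact_mod_cast h1
  generalize Fintype.card (Slot R k × Fin u ↪ Fin n) = X at *
  generalize Fintype.card (Coord R k → Fin u) = Y at *
  push_cast at hbad
  have h5 := mul_le_mul_of_nonneg_left h4 (show (0 : ℝ) ≤ X * (Y * R) by positivity)
  linarith

/-! ### Choice of parameters and conclusion -/

open Classical in
/-- The lower bound with explicit parameters. -/
theorem lower_bound_of_params {κ e s : ℕ} {δ : ℝ} (hn : 2 ^ κ * 64 ^ R * 2 ^ e ≤ n) (hR : 0 < R)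
    (hδ : (16 : ℝ) ^ (2 ^ κ - 1) * δ ≤ 1 / 2) (hP : (URSubset n).HasProtocol δ s) :
    e * (R * 2 ^ κ) ≤ 8 * (s + 2 * (R * 2 ^ κ)) := by
  set k := 2 ^ κ with hkdef
  have hk : 0 < k := by positivity
  set q := (k + 1) / 2 with hq
  set E := Slot R k × Fin (2 ^ e) ↪ Fin n with hE
  have hne : Nonempty E := by
    refine Function.Embedding.nonempty_of_card_le ?_
    rw [Fintype.card_prod, Fintype.card_sigma]
    simp only [Fintype.card_prod, Fintype.card_fin]
    refine le_trans (Nat.mul_le_mul_right _ ?_) hn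
    rw [← mul_sum, Fin.sum_univ_eq_sum_range (fun i => 64 ^ i) R]
    exact Nat.mul_le_mul_left _ (Nat.geomSum_lt (m := 64) (n := R) (s := range R) (by norm_num)
      (fun i hi => mem_range.1 hi)).le
  obtain ⟨msg, ans, hgood⟩ := exists_deterministic hk hR (by positivity) hne hδ hP
  let O : E → (Coord R k → Fin (2 ^ e)) → Fin R → Finset ℕ → Option (Slot R k × Fin (2 ^ e)) :=
    fun π a r => oracle msg ans π a r
  let Good : E × (Coord R k → Fin (2 ^ e)) × Fin R → Prop :=
    fun p => IsGood p.2.1 q (O p.1 p.2.1 p.2.2) p.2.2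
  set X : ℝ := (Fintype.card E : ℝ) with hX
  set Y : ℝ := (Fintype.card (Coord R k → Fin (2 ^ e)) : ℝ) with hY
  have hX0 : 0 < X := Nat.cast_pos.2 Fintype.card_pos
  have hY0 : 0 < Y := Nat.cast_pos.2 Fintype.card_pos
  change X * Y * R / 2 ≤ ((univ.filter Good).card : ℝ) at hgood
  have hmain : q * (univ.filter Good).card ≤
      (∑ π, ∑ a, (freshCoords (O π a) a q).card) + 3 * ∑ a, ∑ r, ∑ π, passLoss (O π a) a q r := by
    have h1 : q * (univ.filter Good).card =
        ∑ π, ∑ a, ∑ r, if IsGood a q (O π a r) r then q else 0 := by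
      rw [mul_comm, ← smul_eq_mul, ← sum_const, sum_filter, Fintype.sum_prod_type]
      refine sum_congr rfl fun π _ => ?_
      rw [Fintype.sum_prod_type]
    have h2 : ∑ a, ∑ r, ∑ π, passLoss (O π a) a q r = ∑ π, ∑ a, ∑ r, passLoss (O π a) a q r := by
      rw [sum_comm (s := (univ : Finset E))]
      exact sum_congr rfl fun a _ => sum_comm
    rw [h1, h2, mul_sum, ← sum_add_distrib]
    refine sum_le_sum fun π _ => ?_
    rw [mul_sum, ← sum_add_distrib]
    exact sum_le_sum fun a _ => sum_isGood_le (O π a) a (by omega)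
  have hloss : (31 : ℝ) * ∑ a, ∑ r, ∑ π, (passLoss (O π a) a q r : ℝ) ≤ Y * (R * (2 * q * X)) := by
    have h1 : 31 * ∑ a, ∑ r, ∑ π, passLoss (O π a) a q r ≤
        ∑ a : Coord R k → Fin (2 ^ e), ∑ r : Fin R, 2 * q * Fintype.card E := by
      rw [mul_sum]
      refine sum_le_sum fun a _ => ?_
      rw [mul_sum]
      exact sum_le_sum fun r _ => sum_passLoss_le msg ans a r hk (by omega)
    rw [sum_const, sum_const, card_univ, card_univ, Fintype.card_fin, smul_eq_mul,
      smul_eq_mul] at h1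
    have h2 : ((31 * ∑ a, ∑ r, ∑ π, passLoss (O π a) a q r : ℕ) : ℝ) ≤ _ := Nat.cast_le.2 h1
    push_cast at h2
    exact h2
  have hfresh : (e : ℝ) * ∑ π, ∑ a, ((freshCoords (O π a) a q).card : ℝ) ≤
      X * ((s + 2 * (R * k)) * Y) := by
    have h1 : e * ∑ π, ∑ a, (freshCoords (O π a) a q).card ≤
        ∑ π : E, (s + 2 * (R * k)) * (2 ^ e) ^ (R * k) := by
      rw [mul_sum]
      exact sum_le_sum fun π _ =>
        sum_card_freshCoords_le (by omega) (by simp) π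
    rw [sum_const, card_univ, smul_eq_mul] at h1
    have hY' : Fintype.card (Coord R k → Fin (2 ^ e)) = (2 ^ e) ^ (R * k) := by simp
    rw [← hY'] at h1
    have h2 : ((e * ∑ π, ∑ a, (freshCoords (O π a) a q).card : ℕ) : ℝ) ≤ _ := Nat.cast_le.2 h1
    push_cast at h2
    exact h2
  have hmain' : (q : ℝ) * (univ.filter Good).card ≤
      (∑ π, ∑ a, ((freshCoords (O π a) a q).card : ℝ)) +
        3 * ∑ a, ∑ r, ∑ π, (passLoss (O π a) a q r : ℝ) := by
    exact_mod_cast hmain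
  have hq2 : (k : ℝ) ≤ 2 * q := by
    have : k ≤ 2 * q := by omega
    exact_mod_cast this
  set S : ℝ := ∑ π, ∑ a, ((freshCoords (O π a) a q).card : ℝ)
  -- The constants fit because `1 / 2 - 3 * (2 / 31) ≥ 1 / 4`.
  have hS : q * (X * Y * R) / 4 ≤ S := by
    have h1 : (q : ℝ) * (X * Y * R / 2) ≤ q * (univ.filter Good).card :=
      mul_le_mul_of_nonneg_left hgood (Nat.cast_nonneg _)
    have h2 : 0 ≤ (q : ℝ) * (X * Y * R) := by positivity
    linarith
  have hfin : (X * Y) * ((e : ℝ) * (R * k)) ≤ (X * Y) * (8 * (s + 2 * (R * k))) := by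
    have h1 : (e : ℝ) * (k * (X * Y * R) / 8) ≤ e * S := by
      refine mul_le_mul_of_nonneg_left (le_trans ?_ hS) (Nat.cast_nonneg _)
      have := mul_le_mul_of_nonneg_right hq2 (show 0 ≤ X * Y * R by positivity)
      linarith
    nlinarith
  have := le_of_mul_le_mul_left hfin (by positivity)
  exact_mod_cast this

theorem hasProtocol_augIndex {N s : ℕ} {δ : ℝ} (hδ : 0 ≤ δ) (h : N ≤ s) :
    (AugIndex N).HasProtocol δ s := by
  refine ⟨⟨Unit, PMF.pure (), fun _ z i => if hi : (i : ℕ) < N then z ⟨i, hi⟩ else false,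
    fun _ m y => m (Fin.castLE h y.1)⟩, fun z y _ => ?_⟩
  have : {r : Unit | ¬ (AugIndex N).correct z y
      ((fun i : Fin s => if hi : (i : ℕ) < N then z ⟨i, hi⟩ else false) (Fin.castLE h y.1))} =
      ∅ := by
    ext
    simp
  rw [OneWayProtocol.failProb]
  simp only [this]
  rw [MeasureTheory.measure_empty, ENNReal.toReal_zero]
  exact hδ

/-- With failure probability below one half, at least one bit has to be sent. -/
theorem one_le_of_hasProtocol {n s : ℕ} {δ : ℝ} (hn : 2 ≤ n) (hδ : δ < 1 / 2)
    (hP : (URSubset n).HasProtocol δ s) : 1 ≤ s := by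
  classical
  by_contra hs
  obtain rfl : s = 0 := by omega
  obtain ⟨P, hP⟩ := hP
  let i : Bool → Fin n := fun b => if b then ⟨0, by omega⟩ else ⟨1, by omega⟩
  let x : Bool → Fin n → Bool := fun b j => decide (j = i b)
  have hi : i true ≠ i false := by simp [i, Fin.ext_iff]
  have hx : ∀ b, (URSubset n).promise (x b) (fun _ => false, 1) := by
    intro b
    refine ⟨fun h => ?_, by simp, ?_⟩
    · have := congrFun h (i b)
      simp [x] at this
    · simp only [x, decide_eq_true_eq, filter_eq', mem_univ, if_true, card_singleton]
  -- As `2 * δ < 1`, one seed is right on both inputs; yet Bob sees the same in both cases.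
  obtain ⟨ω, hω⟩ := exists_seed_forall_notMem P.law (fun b =>
    {ω | ¬ (URSubset n).correct (x b) (fun _ => false, 1)
      (P.output ω (P.message ω (x b)) (fun _ => false, 1))}) (fun b => hP _ _ (hx b))
      (by rw [Fintype.card_bool]; push_cast; linarith)
  have h0 : ∀ b, (URSubset n).correct (x b) (fun _ => false, 1)
      (P.output ω (P.message ω (x b)) (fun _ => false, 1)) := fun b => not_not.1 (hω b)
  have h1 : ∀ b, P.output ω (P.message ω (x b)) (fun _ => false, 1) = i b := by
    intro b
    have := h0 b
    simpa [x] using this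
  apply hi
  rw [← h1 true, ← h1 false, Subsingleton.elim (P.message ω (x true)) (P.message ω (x false))]

/-- The factor `2 ^ p` is split between `64 ^ R` with `R = p / 12` and `2 ^ e` with `e = p / 2`. As
`e ≥ 32`, the overhead `16 * (R * k)` is at most half of `e * (R * k)`. -/
theorem lower_bound_of_pow {n κ p s : ℕ} {δ : ℝ} (hn : 2 ^ κ * 2 ^ p ≤ n) (hp : 64 ≤ p)
    (hδ : (16 : ℝ) ^ (2 ^ κ - 1) * δ ≤ 1 / 2) (hP : (URSubset n).HasProtocol δ s) :
    2 ^ κ * p ^ 2 ≤ 1152 * s := by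
  have h1 : 2 ^ κ * 64 ^ (p / 12) * 2 ^ (p / 2) ≤ n := by
    refine le_trans ?_ hn
    rw [show 64 = 2 ^ 6 by norm_num, ← pow_mul, mul_assoc, ← pow_add]
    exact Nat.mul_le_mul_left _ (Nat.pow_le_pow_right (by norm_num) (by omega))
  have h2 := lower_bound_of_params h1 (by omega) hδ hP
  have h3 : p ≤ 3 * (p / 2) := by omega
  have h4 : p ≤ 24 * (p / 12) := by omega
  have h5 : 32 ≤ p / 2 := by omega
  generalize p / 2 = e at *
  generalize p / 12 = R at *
  generalize 2 ^ κ = k at *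
  have h6 : 32 * (R * k) ≤ e * (R * k) := Nat.mul_le_mul_right _ h5
  calc k * p ^ 2 = k * (p * p) := by ring
    _ ≤ k * (3 * e * (24 * R)) := Nat.mul_le_mul_left _ (Nat.mul_le_mul h3 h4)
    _ = 72 * (e * (R * k)) := by ring
    _ ≤ 1152 * s := by omega

/-- Choice of the parameters for a target number `x` of blocks. -/
theorem exists_params {n s : ℕ} {δ x : ℝ} (hn : 2 ^ 64 ≤ n) (hδ0 : 0 < δ) (hδ : δ < 1 / 2)
    (hx0 : 0 ≤ x) (hxn : x ≤ n / 2 ^ 64) (hxδ : x ≤ Real.log (1 / δ) / 8)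
    (hP : (URSubset n).HasProtocol δ s) :
    ∃ k p : ℕ, 1 ≤ k ∧ 64 ≤ p ∧ n < k * 2 ^ (p + 1) ∧ (k = 1 ∨ (k : ℝ) ≤ x) ∧ x < 2 * k ∧
      k * p ^ 2 ≤ 1152 * s := by
  -- Since `Nat.log 2 0 = 0`, a target `x < 1` gives a single block.
  set κ := Nat.log 2 ⌊x⌋₊ with hκ
  have hk1 : 1 ≤ 2 ^ κ := Nat.one_le_two_pow
  have hk2 : 2 ^ κ = 1 ∨ ((2 ^ κ : ℕ) : ℝ) ≤ x := by
    by_cases h : ⌊x⌋₊ = 0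
    · left
      rw [hκ, h]
      simp
    · right
      exact (Nat.cast_le.2 (Nat.pow_log_le_self 2 h)).trans (Nat.floor_le hx0)
  have hk3 : x < 2 * (2 ^ κ : ℕ) := by
    have h1 : ⌊x⌋₊ + 1 ≤ 2 ^ (κ + 1) := Nat.lt_pow_succ_log_self (by norm_num) _
    have h2 : ((⌊x⌋₊ + 1 : ℕ) : ℝ) ≤ ((2 ^ (κ + 1) : ℕ) : ℝ) := Nat.cast_le.2 h1
    have h3 := Nat.lt_floor_add_one x
    rw [pow_succ] at h2
    push_cast at h2 ⊢
    linarith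
  have hkn : 2 ^ 64 ≤ n / 2 ^ κ := by
    rw [Nat.le_div_iff_mul_le (by positivity)]
    rcases hk2 with h | h
    · rw [h]
      omega
    · have h1 : ((2 ^ κ : ℕ) : ℝ) * 2 ^ 64 ≤ n := by
        rw [← le_div_iff₀ (by positivity)]
        exact h.trans hxn
      rw [mul_comm]
      exact_mod_cast h1
  have hn0 : n / 2 ^ κ ≠ 0 := by
    have : 0 < 2 ^ 64 := by norm_num
    omega
  refine ⟨2 ^ κ, Nat.log 2 (n / 2 ^ κ), hk1, ?_, ?_, hk2, hk3, ?_⟩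
  · exact (Nat.le_log_iff_pow_le (by norm_num) hn0).2 hkn
  · have := Nat.lt_pow_succ_log_self (b := 2) (by norm_num) (n / 2 ^ κ)
    rw [Nat.div_lt_iff_lt_mul (by positivity)] at this
    rwa [mul_comm]
  · refine lower_bound_of_pow (δ := δ) ?_ ((Nat.le_log_iff_pow_le (by norm_num) hn0).2 hkn) ?_ hP
    · rw [mul_comm, ← Nat.le_div_iff_mul_le (by positivity)]
      exact Nat.pow_log_le_self 2 hn0
    · rcases hk2 with h | h
      · rw [h]
        simpa using hδ.le
      · have h16 : (16 : ℝ) ≤ Real.exp 3 := by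
          rw [show (3 : ℝ) = (3 : ℕ) * 1 by norm_num, Real.exp_nat_mul]
          have := Real.exp_one_gt_d9
          calc (16 : ℝ) ≤ 2.7 ^ 3 := by norm_num
            _ ≤ _ := pow_le_pow_left₀ (by norm_num) (by linarith) 3
        have hδe : δ = Real.exp (-Real.log (1 / δ)) := by
          rw [one_div, Real.log_inv, neg_neg, Real.exp_log hδ0]
        calc (16 : ℝ) ^ (2 ^ κ - 1) * δ ≤ Real.exp 3 ^ (2 ^ κ - 1) * δ := by gcongr
          _ = Real.exp (((2 ^ κ - 1 : ℕ) : ℝ) * 3 - Real.log (1 / δ)) := by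
            rw [← Real.exp_nat_mul, sub_eq_add_neg, Real.exp_add, ← hδe]
          _ ≤ Real.exp (-3) := by
            rw [Real.exp_le_exp, Nat.cast_sub hk1, Nat.cast_one]
            linarith
          _ ≤ 1 / 2 := by
            rw [Real.exp_neg, ← one_div]
            exact one_div_le_one_div_of_le (by norm_num) (by linarith)

theorem half_lt_log {δ : ℝ} (hδ0 : 0 < δ) (hδ : δ < 1 / 2) : 1 / 2 < Real.log (1 / δ) := by
  have h1 := Real.log_two_gt_d9
  have h2 : Real.log 2 ≤ Real.log (1 / δ) :=
    Real.log_le_log (by norm_num) (by rw [le_div_iff₀ hδ0]; linarith)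
  linarith

/-- The lower bound for moderate failure probability. -/
theorem urRate_le_of_hasProtocol {n s : ℕ} {δ : ℝ} (hδ0 : 0 < δ) (hδ : δ < 1 / 2)
    (hL : Real.log (1 / δ) < n / (4 * Real.exp 1)) (hP : (URSubset n).HasProtocol δ s) :
    urRate n δ ≤ 2 ^ 200 * s := by
  have hL0 := half_lt_log hδ0 hδ
  have he := Real.exp_one_gt_d9
  rw [lt_div_iff₀ (by positivity)] at hL
  rw [urRate]
  set L := Real.log (1 / δ) with hLdef
  have hLn : L < n := by nlinarith
  have hn2 : 2 ≤ n := by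
    have : (1 : ℝ) < n := by nlinarith
    have : 1 < n := by exact_mod_cast this
    omega
  have hdiv : n / L ≤ 2 * n := by
    rw [div_le_iff₀ (by linarith)]
    nlinarith
  have hlog0 : 0 ≤ Real.log (n / L) := Real.log_nonneg (by rw [le_div_iff₀ (by linarith)]; linarith)
  have hnL : 0 < n / L := div_pos (by linarith) (by linarith)
  by_cases hn : 2 ^ 64 ≤ n
  · obtain ⟨k, p, hk, hp, hnk, hkx, hxk, hs⟩ := exists_params (x := L / 2 ^ 64) hn hδ0 hδ
      (by positivity) (by gcongr) (by rw [← hLdef]; linarith) hP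
    have hk0 : (1 : ℝ) ≤ k := by exact_mod_cast hk
    have hnk' : (n : ℝ) < k * 2 ^ (p + 1) := by exact_mod_cast hnk
    have hs' : (k : ℝ) * p ^ 2 ≤ 1152 * s := by exact_mod_cast hs
    have hp' : (64 : ℝ) ≤ p := by exact_mod_cast hp
    have h1 : n / L ≤ 2 ^ (p + 2) := by
      rw [div_le_iff₀ (by linarith)]
      -- For `k = 1` this is `L > 1 / 2`.
      have h2 : (k : ℝ) ≤ 2 * L := by
        rcases hkx with h | h
        · rw [h, Nat.cast_one]
          linarith
        · linarith
      calc (n : ℝ) ≤ k * 2 ^ (p + 1) := hnk'.le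
        _ ≤ 2 * L * 2 ^ (p + 1) := by gcongr
        _ = 2 ^ (p + 2) * L := by ring
    have h2 : Real.log (n / L) ≤ 2 * p := by
      have h3 := Real.log_le_log hnL h1
      rw [Real.log_pow] at h3
      push_cast at h3
      have := Real.log_two_lt_d9
      nlinarith
    have h3 : L ≤ 2 ^ 65 * k := by linarith
    calc L * Real.log ((n : ℝ) / L) ^ 2 ≤ 2 ^ 65 * (k : ℝ) * (2 * (p : ℝ)) ^ 2 := by gcongr
      _ = 2 ^ 67 * ((k : ℝ) * (p : ℝ) ^ 2) := by ring
      _ ≤ 2 ^ 67 * (1152 * (s : ℝ)) := by gcongr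
      _ ≤ 2 ^ 200 * (s : ℝ) := by
        rw [← mul_assoc]
        gcongr
        norm_num
  · have hs : (1 : ℝ) ≤ s := by exact_mod_cast one_le_of_hasProtocol hn2 hδ hP
    have hn' : (n : ℝ) ≤ 2 ^ 64 := by
      have : n ≤ 2 ^ 64 := by omega
      exact_mod_cast this
    have h1 : Real.log (n / L) ≤ 2 ^ 65 := by
      have := Real.log_le_sub_one_of_pos hnL
      linarith
    calc L * Real.log ((n : ℝ) / L) ^ 2 ≤ 2 ^ 64 * (2 ^ 65) ^ 2 := by
          gcongr
          linarith
      _ ≤ 2 ^ 200 * 1 := by norm_num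
      _ ≤ 2 ^ 200 * (s : ℝ) := by gcongr

/-- The lower bound for small failure probability. -/
theorem le_of_hasProtocol {n s : ℕ} {δ : ℝ} (hn2 : 2 ≤ n) (hδ0 : 0 < δ) (hδ : δ < 1 / 2)
    (hL : n / (4 * Real.exp 1) ≤ Real.log (1 / δ)) (hP : (URSubset n).HasProtocol δ s) :
    (n : ℝ) ≤ 2 ^ 200 * s := by
  have he := Real.exp_one_lt_d9
  rw [div_le_iff₀ (by positivity)] at hL
  have hL0 := half_lt_log hδ0 hδ
  by_cases hn : 2 ^ 64 ≤ n
  · have hn0 : (0 : ℝ) ≤ n := Nat.cast_nonneg _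
    -- Here `n` rather than `δ` limits the number of blocks, and `p ≥ 64` is all that is used of
    -- `p`.
    obtain ⟨k, p, hk, hp, hnk, hkx, hxk, hs⟩ := exists_params (x := n / 2 ^ 70) hn hδ0 hδ
      (by positivity) (by gcongr <;> norm_num) (by nlinarith) hP
    have hs' : (k : ℝ) * p ^ 2 ≤ 1152 * s := by exact_mod_cast hs
    have hp' : (64 : ℝ) ≤ p := by exact_mod_cast hp
    have h1 : (k : ℝ) * 64 ^ 2 ≤ 1152 * s := le_trans (by gcongr) hs'
    have h2 : (0 : ℝ) ≤ s := Nat.cast_nonneg _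
    linarith
  · have hs : (1 : ℝ) ≤ s := by exact_mod_cast one_le_of_hasProtocol hn2 hδ hP
    have hn' : (n : ℝ) ≤ 2 ^ 64 := by
      have : n ≤ 2 ^ 64 := by omega
      exact_mod_cast this
    linarith

/-- The hypothesis gives `n / log (1 / δ) > 4 * e > e ^ 2`, so the squared logarithm is at least
`4`. This absorbs the rounding of `N` to an integer. -/
theorem one_le_urRate {n : ℕ} {δ : ℝ} (hδ0 : 0 < δ) (hδ : δ < 1 / 2)
    (hL : Real.log (1 / δ) < n / (4 * Real.exp 1)) : 1 ≤ urRate n δ := by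
  have hL0 := half_lt_log hδ0 hδ
  have he := Real.exp_one_lt_d9
  have he' := Real.exp_one_gt_d9
  rw [lt_div_iff₀ (by positivity)] at hL
  rw [urRate]
  have h1 : (2 : ℝ) ≤ Real.log (n / Real.log (1 / δ)) := by
    have h3 : Real.exp 1 ^ 2 ≤ n / Real.log (1 / δ) := by
      rw [le_div_iff₀ (by linarith)]
      nlinarith
    have h4 := Real.log_le_log (by positivity) h3
    rw [Real.log_pow, Real.log_exp] at h4
    simpa using h4
  nlinarith

end LowerBound

theorem mainTheorem5 :
    (∃ c₁ c₂ : ℝ, 0 < c₁ ∧ 0 < c₂ ∧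
      ∀ (n : ℕ) (δ : ℝ), 1 ≤ n → 0 < δ → δ < 1 / 2 →
        Real.log (1 / δ) < n / (4 * Real.exp 1) →
        ∃ N : ℕ, c₁ * urRate n δ ≤ N ∧ (N : ℝ) ≤ c₂ * urRate n δ ∧
          (∀ s : ℕ, (URSubset n).HasProtocol δ s → (AugIndex N).HasProtocol (1 / 3) s) ∧
          oneWayPubCC (1 / 3) (AugIndex N) ≤ oneWayPubCC δ (URSubset n)) ∧
    (∃ c : ℝ, 0 < c ∧
      ∀ (n : ℕ) (δ : ℝ), 2 ≤ n → 0 < δ → δ < 1 / 2 →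
        ENNReal.ofReal (c * min (n : ℝ) (urRate n δ)) ≤
          ((oneWayPubCC δ (URSubset n) : ℕ∞) : ℝ≥0∞)) := by
  refine ⟨⟨1 / 2 ^ 200, 2, by positivity, by norm_num, fun n δ _ hδ0 hδ hL => ?_⟩,
    ⟨1 / 2 ^ 200, by positivity, fun n δ hn hδ0 hδ => ?_⟩⟩
  · have h1 := one_le_urRate hδ0 hδ hL
    have h2 : ∀ s : ℕ, (URSubset n).HasProtocol δ s →
        (AugIndex ⌈1 / 2 ^ 200 * urRate n δ⌉₊).HasProtocol (1 / 3) s := fun s hs => by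
      refine hasProtocol_augIndex (by norm_num) (Nat.ceil_le.2 ?_)
      have := urRate_le_of_hasProtocol hδ0 hδ hL hs
      linarith
    refine ⟨⌈1 / 2 ^ 200 * urRate n δ⌉₊, Nat.le_ceil _, ?_, h2,
      le_iInf₂ fun s hs => iInf₂_le s (h2 s hs)⟩
    have := Nat.ceil_lt_add_one (show 0 ≤ 1 / 2 ^ 200 * urRate n δ by positivity)
    linarith
  · have h1 : (⌈1 / 2 ^ 200 * min (n : ℝ) (urRate n δ)⌉₊ : ℕ∞) ≤ oneWayPubCC δ (URSubset n) := by
      refine le_iInf₂ fun s hs => Nat.cast_le.2 (Nat.ceil_le.2 ?_)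
      by_cases hL : Real.log (1 / δ) < n / (4 * Real.exp 1)
      · have h2 := urRate_le_of_hasProtocol hδ0 hδ hL hs
        have h3 := min_le_right (n : ℝ) (urRate n δ)
        linarith
      · have h2 := le_of_hasProtocol hn hδ0 hδ (not_lt.1 hL) hs
        have h3 := min_le_left (n : ℝ) (urRate n δ)
        linarith
    calc ENNReal.ofReal (1 / 2 ^ 200 * min (n : ℝ) (urRate n δ))
        ≤ ENNReal.ofReal (⌈1 / 2 ^ 200 * min (n : ℝ) (urRate n δ)⌉₊ : ℝ) :=
          ENNReal.ofReal_le_ofReal (Nat.le_ceil _)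
      _ = (((⌈1 / 2 ^ 200 * min (n : ℝ) (urRate n δ)⌉₊ : ℕ) : ℕ∞) : ℝ≥0∞) := by
          rw [ENNReal.ofReal_natCast, ENat.toENNReal_coe]
      _ ≤ _ := ENat.toENNReal_le.2 h1
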